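/- A hypergraph $H=(V,E)$ is a finite vertex set $V$ with a set $E$ of subsets of $V$ (edges). It is linear if $|e\cap e'|\le 1$ for all distinct $e,e'\in E$. Its minimum rank is $\rho=\min_{e\in E}|e|$, its maximum rank is $P=\max_{e\in E}|e|$, and $q_{\mathrm{list}}(H)$ is the list chromatic number of its line graph (the graph with vertex set $E$ in which two distinct edges are adjacent iff they intersect). Given an integer $i\ge 3$, a real $\epsilon\in(0,1)$ and a real-valued function $f(i,\epsilon,\cdot)$ on the nonnegative integers, say that $f(i,\epsilon,\cdot)$ is a valid edge-size bound if for every $n\ge 0$, every linear hypergraph $H$ on $n$ vertices with at least one edge, minimum rank $\rho\ge i$ and maximum rank $P\le f(i,\epsilon,n)$ satisfies $$q_{\mathrm{list}}(H)\le(1+\epsilon)\frac{n}{i-1}.$$ Proposition. Let $i\ge 3$ be an integer, let $\epsilon\in(0,1)$, and let $f$ be arbitrary. (1) If for some $\delta>0$ there are infinitely many $n$ with $$f(i,\epsilon,n)>(1+\delta)\sqrt{\frac{(1+\epsilon)n}{i-1}},$$ then $f(i,\epsilon,\cdot)$ is not a valid edge-size bound. (2) Consequently, if $f(i,\epsilon,\cdot)$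 is a valid edge-size bound, then for every $\delta>0$, $$f(i,\epsilon,n)\le(1+\delta)\sqrt{\frac{1+\epsilon}{i-1}}\,\sqrt n\qquad\text{for all sufficiently large } n;$$ in particular $f(i,\epsilon,n)$ is at most a constant times $\sqrt n$ for all large $n$. -/

import Mathlib

/-- `G` is `k`-choosable: whenever every vertex `v` receives a list (palette) `L v` of at least `k`
colors, there is a proper coloring of `G` that colors every vertex from its own list. -/
def SimpleGraph.Choosable {V : Type*} (G : SimpleGraph V) (k : ℕ) : Prop :=
  ∀ (C : Type) (L : V → Finset C), (∀ v, k ≤ (L v).card) →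
    ∃ c : G.Coloring C, ∀ v, c v ∈ L v

/-- The list chromatic number of a graph: the least `k` such that the graph is `k`-choosable. -/
noncomputable def SimpleGraph.listChromaticNumber {V : Type*} (G : SimpleGraph V) : ℕ :=
  sInf {k : ℕ | G.Choosable k}

/-- A finite graph is choosable for some `k`, so that its list chromatic number is a minimum over a
nonempty set. -/
theorem SimpleGraph.choosable_natCard {V : Type*} [Finite V] (G : SimpleGraph V) :
    G.Choosable (Nat.card V) := by
  classical
  intro C L hL
  have := Fintype.ofFinite V
  have hall : ∀ s : Finset V, s.card ≤ (s.biUnion L).card := by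
    intro s
    rcases s.eq_empty_or_nonempty with rfl | ⟨v, hv⟩
    · simp
    · calc s.card ≤ Nat.card V := by
            rw [Nat.card_eq_fintype_card]
            exact Finset.card_le_univ s
        _ ≤ (L v).card := hL v
        _ ≤ (s.biUnion L).card := Finset.card_le_card (Finset.subset_biUnion_of_mem L hv)
  obtain ⟨c, hinj, hc⟩ := (Finset.all_card_le_biUnion_card_iff_exists_injective L).1 hall
  exact ⟨SimpleGraph.Coloring.mk c fun {v w} hvw h => hvw.ne (hinj h), hc⟩

/-- A hypergraph is linear if any two distinct edges share at most one vertex. -/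
def Hypergraph.IsLinear {α : Type*} (H : Hypergraph α) : Prop :=
  ∀ e ∈ H.edgeSet, ∀ e' ∈ H.edgeSet, e ≠ e' → (e ∩ e').Subsingleton

/-- The minimum rank: the smallest size of an edge. -/
noncomputable def Hypergraph.minRank {α : Type*} (H : Hypergraph α) : ℕ :=
  sInf (Set.ncard '' H.edgeSet)

/-- The maximum rank: the largest size of an edge. -/
noncomputable def Hypergraph.maxRank {α : Type*} (H : Hypergraph α) : ℕ :=
  sSup (Set.ncard '' H.edgeSet)

/-- The line graph: its vertices are the edges of `H`, and two distinct edges are adjacent if and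
only if they intersect. -/
def Hypergraph.lineGraph {α : Type*} (H : Hypergraph α) : SimpleGraph H.edgeSet where
  Adj e e' := e ≠ e' ∧ ((e : Set α) ∩ (e' : Set α)).Nonempty
  symm := ⟨fun _ _ h => ⟨h.1.symm, by rw [Set.inter_comm]; exact h.2⟩⟩
  loopless := ⟨fun _ h => h.1 rfl⟩

/-- The list edge chromatic number of a hypergraph. -/
noncomputable def Hypergraph.listEdgeChromaticNumber {α : Type*} (H : Hypergraph α) : ℕ :=
  H.lineGraph.listChromaticNumber

/-- The function `F` is a valid upper bound on the edge sizes (as a function of the number `n` of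
vertices): every linear hypergraph on `n` vertices with all edge sizes between `i` and `F n` has
list edge chromatic number at most `(1 + ε) n / (i - 1)`. -/
def IsValidEdgeSizeBound (i : ℕ) (ε : ℝ) (F : ℕ → ℝ) : Prop :=
  ∀ (n : ℕ) (α : Type) (H : Hypergraph α),
    H.vertexSet.Finite → H.vertexSet.ncard = n → H.IsLinear →
    i ≤ H.minRank → (H.maxRank : ℝ) ≤ F n →
    (H.listEdgeChromaticNumber : ℝ) ≤ (1 + ε) * ((n : ℝ) / ((i : ℝ) - 1))

/-! A projective plane of order `q` is a linear hypergraph with all edges of size `q + 1` whose `q ^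
2 + q + 1` lines meet pairwise. Its line graph is complete, so as many colors are needed; isolated
vertices raise the vertex count to any larger `n`. With `c = (1 + ε) / (i - 1) < 1` and a prime
power `q` slightly above `√(c n)`, the plane fits into `n` vertices, its edges are shorter than `(1
+ δ) √(c n)`, and `q ^ 2 > c n` breaks the bound.

Such `q` exists for all large `n` because prime powers have consecutive ratios tending to 1. This is
proved by testing `Λ` against a kernel `K` of integral 1 that is nonpositive off `[-1, 1]` and has
compactly supported Fourier transform. The pole of `-ζ'/ζ` at 1 contributes `1 / T` in the limit;
the rest vanishes by Riemann–Lebesgue, since it is continuous up to `re s = 1`. If no prime power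
had logarithm within `1 / T` of `y`, every term of the sum would be nonpositive. -/

section

/-! ### The kernel: sign, decay and total mass -/

open MeasureTheory FourierTransform

/-- An even bump supported on `[-1, 1]`. Its Fourier transform is the function
`(1 - cos (2 * π * u)) / (2 * π ^ 2 * u ^ 2 * (1 - u ^ 2))`, which is nonpositive for `1 < |u|`. -/
noncomputable def selbergBump (t : ℝ) : ℝ :=
  1 - min |t| 1 + Real.sin (2 * Real.pi * min |t| 1) / (2 * Real.pi)

theorem continuous_selbergBump : Continuous selbergBump := by
  unfold selbergBump
  fun_prop

theorem selbergBump_eq_zero {t : ℝ} (ht : 1 ≤ |t|) : selbergBump t = 0 := by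
  simp [selbergBump, min_eq_right ht]

theorem selbergBump_zero : selbergBump 0 = 1 := by
  simp [selbergBump]

theorem selbergBump_neg (t : ℝ) : selbergBump (-t) = selbergBump t := by
  simp [selbergBump]

theorem selbergBump_abs (t : ℝ) : selbergBump |t| = selbergBump t := by
  simp [selbergBump]

theorem hasCompactSupport_selbergBump : HasCompactSupport selbergBump := by
  refine HasCompactSupport.intro (isCompact_Icc (a := (-1 : ℝ)) (b := 1)) fun t ht => ?_
  refine selbergBump_eq_zero ?_
  by_contra! h
  exact ht (Set.mem_Icc.2 (abs_le.1 h.le))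

theorem integrable_selbergBump_mul {g : ℝ → ℂ} (hg : Continuous g) :
    Integrable fun t => (selbergBump t : ℂ) * g t := by
  refine Continuous.integrable_of_hasCompactSupport
    ((Complex.continuous_ofReal.comp continuous_selbergBump).mul hg) ?_
  exact (hasCompactSupport_selbergBump.comp_left (g := fun x : ℝ => (x : ℂ)) rfl).mul_right

theorem integrable_selbergBump : Integrable fun t => (selbergBump t : ℂ) := by
  simpa using integrable_selbergBump_mul (g := fun _ => 1) continuous_const

/-- The Fourier transform of `selbergBump`. -/
noncomputable def selbergKernel (u : ℝ) : ℂ :=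
  𝓕 (fun t => (selbergBump t : ℂ)) u

theorem selbergKernel_eq (u : ℝ) :
    selbergKernel u =
      ∫ t : ℝ, (selbergBump t : ℂ) * Complex.exp (-2 * Real.pi * t * u * Complex.I) := by
  rw [selbergKernel, Real.fourier_real_eq_integral_exp_smul]
  refine integral_congr_ae (.of_forall fun t => ?_)
  simp only [smul_eq_mul]
  push_cast
  ring

theorem continuous_selbergKernel : Continuous selbergKernel :=
  VectorFourier.fourierIntegral_continuous Real.continuous_fourierChar
    (by fun_prop) integrable_selbergBump

theorem norm_selbergKernel_le (u : ℝ) :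
    ‖selbergKernel u‖ ≤ ∫ t : ℝ, ‖(selbergBump t : ℂ)‖ :=
  VectorFourier.norm_fourierIntegral_le_integral_norm _ _ _ _ _

theorem selbergKernel_im (u : ℝ) : (selbergKernel u).im = 0 := by
  have h : selbergKernel (-u) = selbergKernel u := by
    rw [selbergKernel_eq, selbergKernel_eq, ← integral_neg_eq_self]
    refine integral_congr_ae (.of_forall fun t => ?_)
    simp [selbergBump_neg]
  have h' : selbergKernel (-u) = (starRingEnd ℂ) (selbergKernel u) := by
    rw [selbergKernel_eq, selbergKernel_eq, ← integral_conj]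
    refine integral_congr_ae (.of_forall fun t => ?_)
    simp [← Complex.exp_conj, Complex.conj_ofNat]
  exact Complex.conj_eq_iff_im.1 (h'.symm.trans h)

theorem selbergKernel_re_eq_integral (u : ℝ) :
    (selbergKernel u).re =
      2 * ∫ t in (0 : ℝ)..1, selbergBump t * Real.cos (2 * Real.pi * u * t) := by
  have h1 : (selbergKernel u).re = ∫ t : ℝ, selbergBump t * Real.cos (2 * Real.pi * u * t) := by
    rw [selbergKernel_eq]
    have hi : Integrable fun t : ℝ =>
        (selbergBump t : ℂ) * Complex.exp (-2 * Real.pi * t * u * Complex.I) :=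
      integrable_selbergBump_mul (by fun_prop)
    rw [← Complex.reCLM_apply, ← Complex.reCLM.integral_comp_comm hi]
    refine integral_congr_ae (.of_forall fun t => ?_)
    have : (-2 * Real.pi * t * u * Complex.I : ℂ) =
      ((-(2 * Real.pi * u * t) : ℝ) : ℂ) * Complex.I := by push_cast; ring
    simp only [Complex.reCLM_apply, Complex.re_ofReal_mul, this, Complex.exp_ofReal_mul_I_re,
      Real.cos_neg]
  have h2 : (∫ t : ℝ, selbergBump t * Real.cos (2 * Real.pi * u * t)) =
      ∫ t : ℝ, (fun s => selbergBump s * Real.cos (2 * Real.pi * u * s)) |t| := by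
    refine integral_congr_ae (.of_forall fun t => ?_)
    simp only [selbergBump_abs]
    congr 1
    rcases abs_cases t with ⟨h, -⟩ | ⟨h, -⟩ <;> simp [h]
  rw [h1, h2, integral_comp_abs (f := fun s => selbergBump s * Real.cos (2 * Real.pi * u * s)),
    intervalIntegral.integral_of_le zero_le_one]
  congr 1
  refine (setIntegral_eq_of_subset_of_forall_sdiff_eq_zero measurableSet_Ioi
    (fun t ht => ht.1) fun t ht => ?_)
  have h0 : (0 : ℝ) < t := ht.1
  have : 1 ≤ |t| := by
    by_contra! h
    exact ht.2 ⟨h0, (le_abs_self t).trans h.le⟩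
  simp [selbergBump_eq_zero this]

theorem selbergKernel_re {u : ℝ} (h0 : u ≠ 0) (h1 : u ^ 2 ≠ 1) :
    (selbergKernel u).re =
      (1 - Real.cos (2 * Real.pi * u)) / (2 * Real.pi ^ 2 * (u ^ 2 * (1 - u ^ 2))) := by
  have hpi := Real.pi_ne_zero
  have h1' : 1 - u ^ 2 ≠ 0 := sub_ne_zero.2 h1.symm
  -- An antiderivative: the first two terms integrate `(1 - t) cos (2πut)` by parts, the last one
  -- integrates `sin (2πt) cos (2πut) / (2π)`.
  set A : ℝ → ℝ := fun t =>
    (1 - t) * Real.sin (2 * Real.pi * u * t) / (2 * Real.pi * u)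
      - Real.cos (2 * Real.pi * u * t) / (2 * Real.pi * u) ^ 2
      - (Real.cos (2 * Real.pi * t) * Real.cos (2 * Real.pi * u * t)
        + u * (Real.sin (2 * Real.pi * t) * Real.sin (2 * Real.pi * u * t)))
        / (4 * Real.pi ^ 2 * (1 - u ^ 2)) with hA
  have hderiv : ∀ t : ℝ, HasDerivAt A
      ((1 - t + Real.sin (2 * Real.pi * t) / (2 * Real.pi)) *
        Real.cos (2 * Real.pi * u * t)) t := by
    intro t
    have hl : ∀ c : ℝ, HasDerivAt (fun t : ℝ => c * t) c t := fun c => by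
      simpa using (hasDerivAt_id t).const_mul c
    have hs := fun c => (hl c).sin
    have hc := fun c => (hl c).cos
    have h := ((((hasDerivAt_id t).const_sub 1).mul (hs (2 * Real.pi * u))).div_const
        (2 * Real.pi * u)).sub ((hc (2 * Real.pi * u)).div_const ((2 * Real.pi * u) ^ 2))
        |>.sub ((((hc (2 * Real.pi)).mul (hc (2 * Real.pi * u))).add
          (((hs (2 * Real.pi)).mul (hs (2 * Real.pi * u))).const_mul u)).div_const
          (4 * Real.pi ^ 2 * (1 - u ^ 2)))
    convert! h using 1
    simp only [id]
    field_simp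
    ring
  have hint : (∫ t in (0 : ℝ)..1, selbergBump t * Real.cos (2 * Real.pi * u * t)) = A 1 - A 0 := by
    rw [← intervalIntegral.integral_eq_sub_of_hasDerivAt (fun t _ => hderiv t)
      (Continuous.intervalIntegrable (by fun_prop) _ _)]
    refine intervalIntegral.integral_congr fun t ht => ?_
    rw [Set.uIcc_of_le zero_le_one] at ht
    simp only [selbergBump, abs_of_nonneg ht.1, min_eq_left ht.2]
  rw [selbergKernel_re_eq_integral, hint, hA]
  simp only [mul_one, mul_zero, Real.cos_zero, Real.sin_zero, Real.cos_two_pi, Real.sin_two_pi]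
  field_simp
  ring

theorem selbergKernel_re_nonpos {u : ℝ} (hu : 1 < |u|) : (selbergKernel u).re ≤ 0 := by
  have h : 1 < u ^ 2 := (one_lt_sq_iff_one_lt_abs u).2 hu
  rw [selbergKernel_re (by rintro rfl; norm_num at h) h.ne']
  refine div_nonpos_of_nonneg_of_nonpos (by linarith [Real.cos_le_one (2 * Real.pi * u)]) ?_
  have : u ^ 2 * (1 - u ^ 2) ≤ 0 := mul_nonpos_of_nonneg_of_nonpos (sq_nonneg u) (by linarith)
  exact mul_nonpos_of_nonneg_of_nonpos (by positivity) this

theorem integrable_selbergKernel : Integrable selbergKernel := by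
  set C := ∫ t : ℝ, ‖(selbergBump t : ℂ)‖
  have hC : 0 ≤ C := integral_nonneg fun _ => norm_nonneg _
  refine Integrable.mono' (integrable_inv_one_add_sq.const_mul (5 * C + 1))
    continuous_selbergKernel.aestronglyMeasurable (.of_forall fun u => ?_)
  rw [← div_eq_mul_inv, le_div_iff₀ (by positivity)]
  -- The closed form decays like `u ^ (-4)` but its denominator vanishes at `0` and `±1`; there the
  -- trivial bound `C` serves.
  rcases le_or_gt (u ^ 2) 4 with h | h
  · calc ‖selbergKernel u‖ * (1 + u ^ 2) ≤ C * 5 :=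
          mul_le_mul (norm_selbergKernel_le u) (by linarith) (by positivity) hC
      _ ≤ 5 * C + 1 := by linarith
  · have hn : ‖selbergKernel u‖ = |(selbergKernel u).re| :=
      ((Complex.abs_re_eq_norm).2 (selbergKernel_im u)).symm
    have hpos : 0 < u ^ 2 * (u ^ 2 - 1) := mul_pos (by linarith) (by linarith)
    have hpi : 1 ≤ Real.pi ^ 2 := by nlinarith [Real.pi_gt_three]
    have hcos : |1 - Real.cos (2 * Real.pi * u)| ≤ 2 := by
      rw [abs_le]
      constructor <;> linarith [Real.cos_le_one (2 * Real.pi * u), Real.neg_one_le_cos (2 * Real.pi * u)]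
    rw [hn, selbergKernel_re (by rintro rfl; norm_num at h) (by intro h'; linarith), abs_div,
      abs_mul, show u ^ 2 * (1 - u ^ 2) = -(u ^ 2 * (u ^ 2 - 1)) by ring, abs_neg, abs_of_pos hpos,
      abs_of_pos (by positivity : 0 < 2 * Real.pi ^ 2), div_mul_eq_mul_div,
      div_le_iff₀ (by positivity)]
    calc |1 - Real.cos (2 * Real.pi * u)| * (1 + u ^ 2) ≤ 2 * (1 + u ^ 2) := by gcongr
      _ ≤ 1 * (2 * 1 * (u ^ 2 * (u ^ 2 - 1))) := by nlinarith
      _ ≤ (5 * C + 1) * (2 * Real.pi ^ 2 * (u ^ 2 * (u ^ 2 - 1))) := by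
        gcongr
        linarith

theorem integral_selbergKernel : ∫ u : ℝ, selbergKernel u = 1 := by
  have h := congrFun (Continuous.fourierInv_fourier_eq
    (Complex.continuous_ofReal.comp continuous_selbergBump) integrable_selbergBump
    integrable_selbergKernel) 0
  rw [Real.fourierInv_eq'] at h
  simpa [selbergBump_zero, selbergKernel, Function.comp_def] using h

/-! ### The pole term and the smoothed sum over `Λ` -/

open Filter Topology in
theorem tendsto_integral_Ioi_selbergKernel {T : ℝ} (hT : 0 < T) :
    Tendsto (fun y : ℝ => ∫ v in Set.Ioi (0 : ℝ), selbergKernel (T * (v - y))) atTop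
      (𝓝 ((T⁻¹ : ℝ) : ℂ)) := by
  have hi : Integrable fun w : ℝ => selbergKernel (T * w) :=
    integrable_selbergKernel.comp_mul_left' hT.ne'
  have hval : ∫ w : ℝ, selbergKernel (T * w) = ((T⁻¹ : ℝ) : ℂ) := by
    rw [Measure.integral_comp_mul_left, integral_selbergKernel, abs_of_pos (inv_pos.2 hT)]
    simp
  rw [← hval]
  have h := (aecover_Ioi (μ := (volume : Measure ℝ))
    tendsto_neg_atTop_atBot).integral_tendsto_of_countably_generated hi
  refine h.congr fun y => ?_
  rw [← (measurePreserving_sub_right (volume : Measure ℝ) y).setIntegral_preimage_emb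
    (MeasurableEquiv.subRight y).measurableEmbedding]
  simp

/-- Write `1 / (a + iτ)` as the Laplace integral of `exp (-(a + iτ) v)` over `v > 0` and apply
Fubini. -/
theorem integral_selbergBump_mul_pole {a : ℝ} (ha : 0 < a) (T y : ℝ) :
    ∫ t : ℝ, (selbergBump t : ℂ) *
        (Complex.exp (2 * Real.pi * T * t * y * Complex.I) *
          (1 / (a + 2 * Real.pi * T * t * Complex.I))) =
      ∫ v in Set.Ioi (0 : ℝ), Complex.exp (-(a * v)) * selbergKernel (T * (v - y)) := by
  set F : ℝ → ℝ → ℂ := fun t v => (selbergBump t : ℂ) *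
    (Complex.exp (2 * Real.pi * T * t * y * Complex.I) *
      Complex.exp (-(a + 2 * Real.pi * T * t * Complex.I) * v)) with hF
  have hint : Integrable (Function.uncurry F)
      ((volume : Measure ℝ).prod (volume.restrict (Set.Ioi (0 : ℝ)))) := by
    have h1 := integrable_selbergBump.norm.mul_prod
      (exp_neg_integrableOn_Ioi 0 ha : Integrable _ (volume.restrict (Set.Ioi (0 : ℝ))))
    have hc : Continuous (Function.uncurry F) := by
      have := continuous_selbergBump
      rw [hF]
      unfold Function.uncurry
      fun_prop
    refine h1.mono' hc.aestronglyMeasurable (.of_forall fun ⟨t, v⟩ => ?_)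
    simp [hF, Complex.norm_exp]
  calc _ = ∫ t : ℝ, ∫ v in Set.Ioi (0 : ℝ), F t v := by
        refine integral_congr_ae (.of_forall fun t => ?_)
        simp only [hF]
        rw [integral_const_mul, integral_const_mul, integral_exp_mul_complex_Ioi (by simp [ha])]
        simp [neg_div, div_neg, - neg_add_rev]
    _ = ∫ v in Set.Ioi (0 : ℝ), ∫ t : ℝ, F t v := integral_integral_swap hint
    _ = _ := by
        refine integral_congr_ae (.of_forall fun v => ?_)
        simp only [hF]
        rw [selbergKernel_eq, ← integral_const_mul]
        refine integral_congr_ae (.of_forall fun t => ?_)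
        simp only
        rw [← Complex.exp_add, mul_left_comm, ← Complex.exp_add]
        congr 2
        push_cast
        ring

-- Absolute convergence for `re s > 1` permits termwise integration; each `n ^ (-2πiTt)` turns into
-- a shift of the kernel to `log n`.
open ArithmeticFunction in
theorem hasSum_vonMangoldt_mul_selbergKernel {s : ℝ} (hs : 1 < s) (T y : ℝ) :
    HasSum (fun n : ℕ => ((Λ n * (n : ℝ) ^ (-s) : ℝ) : ℂ) * selbergKernel (T * (Real.log n - y)))
      (∫ t : ℝ, (selbergBump t : ℂ) *
        (Complex.exp (2 * Real.pi * T * t * y * Complex.I) *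
          LSeries (fun n => (Λ n : ℂ)) (s + 2 * Real.pi * T * t * Complex.I))) := by
  set F : ℕ → ℝ → ℂ := fun n t => (selbergBump t : ℂ) *
    (Complex.exp (2 * Real.pi * T * t * y * Complex.I) *
      LSeries.term (fun n => (Λ n : ℂ)) (s + 2 * Real.pi * T * t * Complex.I) n) with hF
  have hterm : ∀ (n : ℕ) (t : ℝ),
      LSeries.term (fun n => (Λ n : ℂ)) (s + 2 * Real.pi * T * t * Complex.I) n =
      ((Λ n * (n : ℝ) ^ (-s) : ℝ) : ℂ) *
        Complex.exp (-(2 * Real.pi * T * t * Real.log n * Complex.I)) := by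
    intro n t
    rcases eq_or_ne n 0 with rfl | hn
    · simp
    · have hn' : (n : ℂ) ≠ 0 := Nat.cast_ne_zero.2 hn
      rw [LSeries.term_of_ne_zero hn, div_eq_mul_inv, ← Complex.cpow_neg]
      rw [neg_add, Complex.cpow_add _ _ hn', Complex.ofReal_mul,
        Complex.ofReal_cpow (Nat.cast_nonneg n), mul_assoc (Λ n : ℂ), Complex.ofReal_neg,
        Complex.ofReal_natCast, Complex.cpow_def_of_ne_zero hn' (-(2 * _ * _ * _ * _)),
        ← Complex.natCast_log]
      congr 3
      ring
  have hF_eq : ∀ n t, F n t = ((Λ n * (n : ℝ) ^ (-s) : ℝ) : ℂ) * ((selbergBump t : ℂ) *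
      Complex.exp (-2 * Real.pi * t * (T * (Real.log n - y) : ℝ) * Complex.I)) := by
    intro n t
    simp only [hF]
    rw [hterm, mul_left_comm _ (Complex.ofReal _) (Complex.exp _), ← Complex.exp_add,
      mul_left_comm]
    congr 3
    push_cast
    ring
  have hFi : ∀ n, Integrable (F n) := by
    intro n
    simp only [funext (hF_eq n)]
    exact (integrable_selbergBump_mul (by fun_prop)).const_mul _
  have hnorm : ∀ n, ∫ t : ℝ, ‖F n t‖ = (Λ n * (n : ℝ) ^ (-s)) * ∫ t : ℝ, ‖(selbergBump t : ℂ)‖ := by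
    intro n
    rw [← integral_const_mul]
    refine integral_congr_ae (.of_forall fun t => ?_)
    have he : ‖Complex.exp (-2 * Real.pi * t * (T * (Real.log n - y) : ℝ) * Complex.I)‖ = 1 := by
      rw [show (-2 * Real.pi * t * (T * (Real.log n - y) : ℝ) * Complex.I : ℂ) =
        ((-2 * Real.pi * t * (T * (Real.log n - y)) : ℝ) : ℂ) * Complex.I by push_cast; ring,
        Complex.norm_exp_ofReal_mul_I]
    have h0 : 0 ≤ Λ n * (n : ℝ) ^ (-s) := mul_nonneg vonMangoldt_nonneg (by positivity)
    simp only [hF_eq]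
    rw [norm_mul, norm_mul, he, mul_one, Complex.norm_of_nonneg h0]
  have hsum : Summable fun n : ℕ => Λ n * (n : ℝ) ^ (-s) := by
    have h := (LSeriesSummable_vonMangoldt (s := (s : ℂ)) (by simpa using hs)).norm
    refine h.congr fun n => ?_
    have := hterm n 0
    simp only [Complex.ofReal_zero, mul_zero, zero_mul, add_zero, neg_zero, Complex.exp_zero,
      mul_one] at this
    rw [this, Complex.norm_real, Real.norm_of_nonneg]
    exact mul_nonneg vonMangoldt_nonneg (by positivity)
  have h := hasSum_integral_of_summable_integral_norm hFi (by
    simp only [hnorm]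
    exact hsum.mul_right _)
  convert! h using 1
  · funext n
    rw [selbergKernel_eq, ← integral_const_mul]
    simp only [hF_eq]
  · refine integral_congr_ae (.of_forall fun t => ?_)
    simp only [hF, tsum_mul_left]
    rfl

/-! ### Separating the pole and passing to the line `re s = 1` -/

/-- The function `-ζ'(s)/ζ(s) - 1/(s - 1)`, continuously extended to `1 ≤ re s`. -/
noncomputable def vonMangoldtRegularPart : ℂ → ℂ :=
  ArithmeticFunction.vonMangoldt.LFunctionResidueClassAux (1 : ZMod 1)

/-- The arithmetic input: nonvanishing of `ζ` on `re s = 1`, in its form for Dirichlet L-functions,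
at modulus 1. -/
theorem continuousOn_vonMangoldtRegularPart :
    ContinuousOn vonMangoldtRegularPart {s | 1 ≤ s.re} :=
  ArithmeticFunction.vonMangoldt.continuousOn_LFunctionResidueClassAux 1

open ArithmeticFunction in
theorem LSeries_vonMangoldt_eq_pole_add {s : ℂ} (hs : 1 < s.re) :
    LSeries (fun n => (Λ n : ℂ)) s = 1 / (s - 1) + vonMangoldtRegularPart s := by
  have h := vonMangoldt.eqOn_LFunctionResidueClassAux (a := (1 : ZMod 1)) isUnit_one
    (show s ∈ {s : ℂ | 1 < s.re} from hs)
  have hr : ∀ n : ℕ, vonMangoldt.residueClass (1 : ZMod 1) n = Λ n := fun n =>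
    Set.indicator_of_mem (show n ∈ {n : ℕ | (n : ZMod 1) = 1} from Subsingleton.elim _ _) _
  simp only [hr, Nat.totient_one, Nat.cast_one, inv_one] at h
  rw [vonMangoldtRegularPart, h]
  ring

/-- The contribution of the regular part of `-ζ'/ζ` on the line `re s = 1 + a`. -/
noncomputable def regularContribution (T y a : ℝ) : ℂ :=
  ∫ t : ℝ, (selbergBump t : ℂ) * (Complex.exp (2 * Real.pi * T * t * y * Complex.I) *
    vonMangoldtRegularPart ((1 + a : ℝ) + 2 * Real.pi * T * t * Complex.I))

theorem continuous_regularPart_line {a : ℝ} (ha : 0 ≤ a) (T : ℝ) :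
    Continuous fun t : ℝ =>
      vonMangoldtRegularPart ((1 + a : ℝ) + 2 * Real.pi * T * t * Complex.I) := by
  refine continuousOn_vonMangoldtRegularPart.comp_continuous (by fun_prop) fun t => ?_
  simp [ha]

open ArithmeticFunction in
theorem hasSum_vonMangoldt_mul_selbergKernel_eq {a : ℝ} (ha : 0 < a) (T y : ℝ) :
    HasSum (fun n : ℕ =>
        ((Λ n * (n : ℝ) ^ (-(1 + a)) : ℝ) : ℂ) * selbergKernel (T * (Real.log n - y)))
      ((∫ v in Set.Ioi (0 : ℝ), Complex.exp (-(a * v)) * selbergKernel (T * (v - y))) +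
        regularContribution T y a) := by
  convert! hasSum_vonMangoldt_mul_selbergKernel (by linarith : 1 < 1 + a) T y using 1
  have hre : ∀ t : ℝ, (a + 2 * Real.pi * T * t * Complex.I : ℂ) ≠ 0 := fun t h => by
    have := congrArg Complex.re h
    simp at this
    exact ha.ne' this
  rw [← integral_selbergBump_mul_pole ha, regularContribution, ← integral_add]
  · refine integral_congr_ae (.of_forall fun t => ?_)
    simp only
    rw [LSeries_vonMangoldt_eq_pole_add (by simp [ha]), ← mul_add, ← mul_add]
    congr 4
    push_cast
    ring
  · exact integrable_selbergBump_mul (by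
      refine Continuous.mul (by fun_prop) (Continuous.div₀ (by fun_prop) (by fun_prop) hre))
  · exact integrable_selbergBump_mul
      (Continuous.mul (by fun_prop) (continuous_regularPart_line ha.le T))

-- The bump confines `t` to `[-1, 1]`, so the regular part is bounded on a compact set and dominated
-- convergence applies.
open Filter Topology in
theorem tendsto_regularContribution_zero (T y : ℝ) :
    Tendsto (regularContribution T y) (𝓝[>] 0) (𝓝 (regularContribution T y 0)) := by
  have hcont : ContinuousOn (fun p : ℝ × ℝ =>
      vonMangoldtRegularPart ((1 + p.1 : ℝ) + 2 * Real.pi * T * p.2 * Complex.I))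
      (Set.Ici 0 ×ˢ Set.univ) := by
    refine continuousOn_vonMangoldtRegularPart.comp (by fun_prop) fun p hp => ?_
    have : 0 ≤ p.1 := hp.1
    simp [this]
  obtain ⟨M, hM⟩ := (isCompact_Icc.prod isCompact_Icc :
      IsCompact (Set.Icc (0 : ℝ) 1 ×ˢ Set.Icc (-1 : ℝ) 1)).exists_bound_of_continuousOn
    (hcont.mono (Set.prod_mono Set.Icc_subset_Ici_self (Set.subset_univ _)))
  refine tendsto_integral_filter_of_dominated_convergence
    (fun t => ‖(selbergBump t : ℂ)‖ * M) ?_ ?_ (integrable_selbergBump.norm.mul_const _) ?_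
  · filter_upwards [self_mem_nhdsWithin] with a ha
    have := continuous_regularPart_line (le_of_lt ha) T
    have := continuous_selbergBump
    exact Continuous.aestronglyMeasurable (by fun_prop)
  · filter_upwards [Ioo_mem_nhdsGT (zero_lt_one' ℝ)] with a ha
    refine .of_forall fun t => ?_
    rcases le_or_gt 1 |t| with ht | ht
    · simp [selbergBump_eq_zero ht]
    · have h1 : ‖Complex.exp (2 * Real.pi * T * t * y * Complex.I)‖ = 1 := by
        rw [show (2 * Real.pi * T * t * y * Complex.I : ℂ) =
          ((2 * Real.pi * T * t * y : ℝ) : ℂ) * Complex.I by push_cast; ring,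
          Complex.norm_exp_ofReal_mul_I]
      rw [norm_mul, norm_mul, h1, one_mul]
      exact mul_le_mul_of_nonneg_left (hM (a, t) ⟨⟨ha.1.le, ha.2.le⟩, abs_le.1 ht.le⟩)
        (norm_nonneg _)
  · refine .of_forall fun t => ?_
    refine Tendsto.const_mul _ (Tendsto.const_mul _ ?_)
    have h := (hcont (0, t) ⟨Set.self_mem_Ici, trivial⟩).tendsto
    refine Tendsto.comp (f := fun a : ℝ => (a, t)) h (tendsto_nhdsWithin_iff.2 ⟨?_, ?_⟩)
    · exact ((continuous_id.prodMk continuous_const).tendsto' (0 : ℝ) (0, t) rfl).mono_left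
        nhdsWithin_le_nhds
    · filter_upwards [self_mem_nhdsWithin] with a ha
      exact ⟨Set.mem_Ici.2 (le_of_lt (Set.mem_Ioi.1 ha)), trivial⟩

open Filter Topology in
theorem tendsto_integral_exp_mul_selbergKernel {T : ℝ} (hT : 0 < T) (y : ℝ) :
    Tendsto (fun a : ℝ => ∫ v in Set.Ioi (0 : ℝ),
        Complex.exp (-(a * v)) * selbergKernel (T * (v - y))) (𝓝[>] 0)
      (𝓝 (∫ v in Set.Ioi (0 : ℝ), selbergKernel (T * (v - y)))) := by
  have hi : Integrable fun v : ℝ => selbergKernel (T * (v - y)) :=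
    (integrable_selbergKernel.comp_mul_left' hT.ne').comp_sub_right y
  have hc := continuous_selbergKernel
  refine tendsto_integral_filter_of_dominated_convergence
    (fun v => ‖selbergKernel (T * (v - y))‖) ?_ ?_ hi.norm.integrableOn ?_
  · exact .of_forall fun a => Continuous.aestronglyMeasurable (by fun_prop)
  · filter_upwards [self_mem_nhdsWithin] with a ha
    filter_upwards [ae_restrict_mem measurableSet_Ioi] with v hv
    have h : ‖Complex.exp (-(a * v))‖ ≤ 1 := by
      have : 0 ≤ a * v := mul_nonneg (le_of_lt ha) (le_of_lt hv)
      rw [Complex.norm_exp]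
      simpa using this
    rw [norm_mul]
    exact mul_le_of_le_one_left (norm_nonneg _) h
  · refine .of_forall fun v => ?_
    have h : Continuous fun a : ℝ => Complex.exp (-(a * v)) * selbergKernel (T * (v - y)) := by
      fun_prop
    exact (h.tendsto' 0 _ (by simp)).mono_left nhdsWithin_le_nhds

-- Riemann–Lebesgue: `y` enters only through the frequency `-T y`.
open Filter Topology in
theorem tendsto_regularContribution_atTop {T : ℝ} (hT : 0 < T) :
    Tendsto (fun y => regularContribution T y 0) atTop (𝓝 0) := by
  have h := Real.zero_at_infty_fourier (fun t : ℝ => (selbergBump t : ℂ) *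
    vonMangoldtRegularPart ((1 + 0 : ℝ) + 2 * Real.pi * T * t * Complex.I))
  have hy : Tendsto (fun y : ℝ => -(T * y)) atTop (cocompact ℝ) :=
    (tendsto_neg_atTop_atBot.comp (tendsto_id.const_mul_atTop hT)).mono_right atBot_le_cocompact
  refine (h.comp hy).congr fun y => ?_
  rw [Function.comp_apply, Real.fourier_real_eq_integral_exp_smul, regularContribution]
  refine integral_congr_ae (.of_forall fun t => ?_)
  simp only [smul_eq_mul]
  rw [mul_left_comm]
  congr 3
  push_cast
  ring

open Filter Topology ArithmeticFunction in
/-- Every sufficiently large interval of a fixed logarithmic length contains a prime power. -/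
theorem eventually_exists_isPrimePow_log_close {T : ℝ} (hT : 0 < T) :
    ∀ᶠ y : ℝ in atTop, ∃ n : ℕ, IsPrimePow n ∧ |T * (Real.log n - y)| ≤ 1 := by
  have hlim := (tendsto_integral_Ioi_selbergKernel hT).add (tendsto_regularContribution_atTop hT)
  rw [add_zero] at hlim
  have hre := (Complex.continuous_re.tendsto _).comp hlim
  rw [Complex.ofReal_re] at hre
  filter_upwards [hre.eventually (lt_mem_nhds (inv_pos.2 hT))] with y hy
  -- For each `a > 0` the sum is now nonpositive: `Λ` vanishes off prime powers, and on them the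
  -- kernel is nonpositive. Letting `a → 0` contradicts the positive limit value `hy`.
  by_contra! hno
  refine hy.not_ge ?_
  have ha := (Complex.continuous_re.tendsto _).comp
    ((tendsto_integral_exp_mul_selbergKernel hT y).add (tendsto_regularContribution_zero T y))
  refine le_of_tendsto ha ?_
  filter_upwards [self_mem_nhdsWithin] with a ha
  have hs := Complex.hasSum_re (hasSum_vonMangoldt_mul_selbergKernel_eq ha T y)
  refine hs.nonpos fun n => ?_
  rw [Complex.re_ofReal_mul]
  by_cases hn : IsPrimePow n
  · refine mul_nonpos_of_nonneg_of_nonpos (mul_nonneg vonMangoldt_nonneg (by positivity)) ?_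
    exact selbergKernel_re_nonpos (hno n hn)
  · rw [vonMangoldt_eq_zero_iff.2 hn]
    simp

end

/-! ### Projective planes as linear hypergraphs -/

/-- The colors of a complete graph with equal lists are distinct. -/
theorem SimpleGraph.natCard_le_listChromaticNumber {V : Type*} [Finite V] {G : SimpleGraph V}
    (hG : ∀ v w, v ≠ w → G.Adj v w) : Nat.card V ≤ G.listChromaticNumber := by
  have hmem : G.Choosable G.listChromaticNumber :=
    Nat.sInf_mem (s := {k | G.Choosable k}) ⟨_, G.choosable_natCard⟩
  obtain ⟨c, -⟩ := hmem (Fin G.listChromaticNumber) (fun _ => Finset.univ) (fun _ => by simp)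
  have hinj : Function.Injective c := fun v w h => by
    by_contra hne
    exact c.valid (hG v w hne) h
  simpa using Nat.card_le_card_of_injective c hinj

namespace Configuration

variable (P L : Type*) [Membership P L]

/-- The hypergraph whose edges are the lines of a configuration, with extra isolated vertices. -/
def paddedHypergraph (ι : Type*) : Hypergraph (P ⊕ ι) where
  vertexSet := Set.univ
  edgeSet := Set.range fun l : L => Sum.inl '' {p : P | p ∈ l}
  subset_vertexSet_of_mem_edgeSet' := fun _ _ => Set.subset_univ _

variable [ProjectivePlane P L] (ι : Type*)

theorem isLinear_paddedHypergraph : (paddedHypergraph P L ι).IsLinear := by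
  rintro _ ⟨l, rfl⟩ _ ⟨m, rfl⟩ hne _ ⟨⟨p, hp, rfl⟩, ⟨p', hp', h⟩⟩ _ ⟨⟨r, hr, rfl⟩, ⟨r', hr', h'⟩⟩
  obtain rfl := Sum.inl_injective h
  obtain rfl := Sum.inl_injective h'
  rcases Nondegenerate.eq_or_eq (l₁ := l) (l₂ := m) hp hr hp' hr' with h | h
  · exact congrArg Sum.inl h
  · exact absurd (by rw [h]) hne

variable [Finite P] [Finite L]

theorem ncard_image_paddedHypergraph :
    Set.ncard '' (paddedHypergraph P L ι).edgeSet = {ProjectivePlane.order P L + 1} := by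
  have h : ∀ l : L,
      ((Sum.inl : P → P ⊕ ι) '' {p : P | p ∈ l}).ncard = ProjectivePlane.order P L + 1 := by
    intro l
    rw [Set.ncard_image_of_injective _ Sum.inl_injective, ← ProjectivePlane.pointCount_eq P l]
    rfl
  obtain ⟨-, -, -, l, -⟩ := @ProjectivePlane.exists_config P L _ _
  refine Set.eq_singleton_iff_unique_mem.2 ⟨⟨_, ⟨l, rfl⟩, h l⟩, ?_⟩
  rintro _ ⟨_, ⟨m, rfl⟩, rfl⟩
  exact h m

theorem minRank_paddedHypergraph :
    (paddedHypergraph P L ι).minRank = ProjectivePlane.order P L + 1 := by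
  rw [Hypergraph.minRank, ncard_image_paddedHypergraph, csInf_singleton]

theorem maxRank_paddedHypergraph :
    (paddedHypergraph P L ι).maxRank = ProjectivePlane.order P L + 1 := by
  rw [Hypergraph.maxRank, ncard_image_paddedHypergraph, csSup_singleton]

/-- Any two lines meet, so the line graph is complete; distinct lines give distinct edges because a
line has at least two points. -/
theorem le_listEdgeChromaticNumber_paddedHypergraph :
    Nat.card L ≤ (paddedHypergraph P L ι).listEdgeChromaticNumber := by
  have hinj : Function.Injective fun l : L => (Sum.inl : P → P ⊕ ι) '' {p : P | p ∈ l} := by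
    intro l m h
    have h' : ∀ p : P, p ∈ l ↔ p ∈ m := Set.ext_iff.1 (Sum.inl_injective.image_injective h)
    have hone : 1 < Nat.card {p : P // p ∈ l} := by
      have := ProjectivePlane.two_lt_pointCount P l
      exact lt_trans one_lt_two this
    obtain ⟨⟨p, hp⟩, ⟨r, hr⟩, hpr⟩ := (Finite.one_lt_card_iff_nontrivial.1 hone).exists_pair_ne
    exact (Nondegenerate.eq_or_eq hp hr ((h' p).1 hp) ((h' r).1 hr)).resolve_left
      fun h => hpr (Subtype.ext h)
  have hcard : Nat.card (paddedHypergraph P L ι).edgeSet = Nat.card L :=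
    Nat.card_range_of_injective hinj
  have : Finite (paddedHypergraph P L ι).edgeSet := Set.finite_range _
  rw [← hcard]
  refine SimpleGraph.natCard_le_listChromaticNumber ?_
  rintro ⟨_, ⟨l, rfl⟩⟩ ⟨_, ⟨m, rfl⟩⟩ hne
  have hlm : l ≠ m := by
    rintro rfl
    exact hne rfl
  obtain ⟨h1, h2⟩ := HasPoints.mkPoint_ax (P := P) hlm
  exact ⟨hne, _, ⟨_, h1, rfl⟩, ⟨_, h2, rfl⟩⟩

end Configuration

open Configuration LinearAlgebra.Projectivization in
/-- A projective plane of prime power order `q`, with isolated vertices added. -/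
theorem exists_hypergraph_of_isPrimePow {q n : ℕ} (hq : IsPrimePow q) (hn : q ^ 2 + q + 1 ≤ n) :
    ∃ (α : Type) (H : Hypergraph α), H.vertexSet.Finite ∧ H.vertexSet.ncard = n ∧ H.IsLinear ∧
      H.minRank = q + 1 ∧ H.maxRank = q + 1 ∧ q ^ 2 + q + 1 ≤ H.listEdgeChromaticNumber := by
  classical
  obtain ⟨p, k, hp, hk, rfl⟩ := hq
  have : Fact p.Prime := ⟨hp.nat_prime⟩
  set K := GaloisField p k
  have hK : Nat.card K = p ^ k := GaloisField.card p k hk.ne'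
  set X := ℙ K (Fin 3 → K)
  have hfin : Finite X := inferInstance
  have := Fintype.ofFinite X
  have hX : Nat.card X = (p ^ k) ^ 2 + p ^ k + 1 := by
    rw [Projectivization.card_of_finrank K (Fin 3 → K) (n := 3) (by simp), hK]
    simp [Finset.sum_range_succ]
    ring
  have hord : ProjectivePlane.order X X = p ^ k := by
    have h := ProjectivePlane.card_points X X
    rw [← Nat.card_eq_fintype_card, hX] at h
    nlinarith
  refine ⟨_, paddedHypergraph X X (Fin (n - Nat.card X)), Set.toFinite _, ?_,
    isLinear_paddedHypergraph X X _, ?_, ?_, ?_⟩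
  · rw [paddedHypergraph, Set.ncard_univ, Nat.card_sum, Nat.card_fin]
    omega
  · rw [minRank_paddedHypergraph, hord]
  · rw [maxRank_paddedHypergraph, hord]
  · rw [← hX]
    exact le_listEdgeChromaticNumber_paddedHypergraph ..

/-! ### Choosing the order of the plane -/

open Filter Topology in
/-- Prime powers in short intervals: for `1 < r`, the interval `(y, r * y)` contains a prime power
whenever `y` is large. -/
theorem eventually_exists_isPrimePow_Ioo {r : ℝ} (hr : 1 < r) :
    ∀ᶠ y : ℝ in atTop, ∃ q : ℕ, IsPrimePow q ∧ y < q ∧ (q : ℝ) < r * y := by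
  have hlr : 0 < Real.log r := Real.log_pos hr
  -- A window of radius `log r / 4` about the midpoint `log y + log r / 2` lies strictly inside
  -- `(log y, log (r y))`.
  have hT : 0 < 4 / Real.log r := by positivity
  have htend : Tendsto (fun y : ℝ => Real.log y + Real.log r / 2) atTop atTop :=
    tendsto_atTop_add_const_right _ _ Real.tendsto_log_atTop
  filter_upwards [htend.eventually (eventually_exists_isPrimePow_log_close hT),
    eventually_gt_atTop 0] with y hy hy0
  obtain ⟨q, hq, hlog⟩ := hy
  have hq0 : (0 : ℝ) < q := Nat.cast_pos.2 hq.pos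
  rw [abs_mul, abs_of_pos hT, div_mul_eq_mul_div, div_le_one hlr] at hlog
  have hlog' := abs_le.1 (by linarith :
    |Real.log q - (Real.log y + Real.log r / 2)| ≤ Real.log r / 4)
  refine ⟨q, hq, (Real.log_lt_log_iff hy0 hq0).1 (by linarith), ?_⟩
  refine (Real.log_lt_log_iff hq0 (by positivity)).1 ?_
  rw [Real.log_mul (by positivity) hy0.ne']
  linarith

open Filter Topology in
theorem not_isValidEdgeSizeBound_of_infinite {i : ℕ} (hi : 3 ≤ i) {ε : ℝ} (hε0 : 0 < ε)
    (hε1 : ε < 1) {F : ℕ → ℝ} {δ : ℝ} (hδ : 0 < δ)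
    (hinf : {n : ℕ | (1 + δ) * Real.sqrt ((1 + ε) * (n : ℝ) / ((i : ℝ) - 1)) < F n}.Infinite) :
    ¬ IsValidEdgeSizeBound i ε F := by
  have hi1 : (2 : ℝ) ≤ (i : ℝ) - 1 := by
    have : (3 : ℝ) ≤ i := by exact_mod_cast hi
    linarith
  set c : ℝ := (1 + ε) / ((i : ℝ) - 1) with hc
  have hc0 : 0 < c := div_pos (by linarith) (by linarith)
  have hc1 : c < 1 := (div_lt_one (by linarith)).2 (by linarith)
  have hcn : ∀ n : ℕ, (1 + ε) * (n : ℝ) / ((i : ℝ) - 1) = c * n := fun n => by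
    rw [hc]; ring
  -- a ratio `1 + 2 * η ≤ 1 + δ` with `(1 + 2 * η) ^ 2 * c ≤ 1`
  obtain ⟨η, hη0, hηδ, hηc⟩ : ∃ η : ℝ, 0 < η ∧ 1 + 2 * η ≤ 1 + δ ∧ (1 + 2 * η) ^ 2 * c ≤ 1 := by
    have hlim : Tendsto (fun η : ℝ => (1 + 2 * η) ^ 2 * c) (𝓝[>] 0) (𝓝 c) :=
      (Continuous.tendsto' (by fun_prop) 0 c (by simp)).mono_left nhdsWithin_le_nhds
    obtain ⟨η, h1, h2⟩ := ((hlim.eventually (gt_mem_nhds hc1)).and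
      (Ioo_mem_nhdsGT (half_pos hδ))).exists
    exact ⟨η, h2.1, by linarith [h2.2], h1.le⟩
  have hsqrt : Tendsto (fun n : ℕ => Real.sqrt (c * n)) atTop atTop :=
    Real.tendsto_sqrt_atTop.comp (tendsto_natCast_atTop_atTop.const_mul_atTop hc0)
  -- With `y = √(c n)`, `y ≥ 1 / η` lets the second `η` absorb the `+ 1` in `q + 1`, and `y ≥ i`
  -- ensures the minimum rank.
  have hev := (hsqrt.eventually (eventually_exists_isPrimePow_Ioo (by linarith : 1 < 1 + η))).and
    (hsqrt.eventually (eventually_ge_atTop (max (i : ℝ) (1 / η))))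
  obtain ⟨n, hnF, ⟨q, hq, hyq, hqy⟩, hlarge⟩ :=
    ((Nat.frequently_atTop_iff_infinite.2 hinf).and_eventually hev).exists
  rw [hcn] at hnF
  set y := Real.sqrt (c * n) with hy
  have hy0 : 0 ≤ y := Real.sqrt_nonneg _
  have hysq : y ^ 2 = c * n := Real.sq_sqrt (by positivity)
  have hyη : 1 ≤ η * y := by
    have := (le_max_right _ _).trans hlarge
    rwa [div_le_iff₀' hη0] at this
  have hq1 : (q : ℝ) + 1 ≤ (1 + 2 * η) * y := by linarith
  have hqn : q ^ 2 + q + 1 ≤ n := by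
    have h : ((q : ℝ) + 1) ^ 2 ≤ n := calc
      ((q : ℝ) + 1) ^ 2 ≤ ((1 + 2 * η) * y) ^ 2 := by gcongr
      _ = (1 + 2 * η) ^ 2 * c * n := by rw [mul_pow, hysq]; ring
      _ ≤ 1 * n := by gcongr
      _ = n := one_mul _
    have h' : (q + 1) ^ 2 ≤ n := by exact_mod_cast h
    nlinarith
  obtain ⟨α, H, hfin, hcard, hlin, hmin, hmax, hlist⟩ := exists_hypergraph_of_isPrimePow hq hqn
  intro hvalid
  have hiq : i ≤ q := by
    have : (i : ℝ) ≤ q := ((le_max_left _ _).trans hlarge).trans hyq.le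
    exact_mod_cast this
  have h := hvalid n α H hfin hcard hlin (by omega) (by
    rw [hmax]
    push_cast
    have : (1 + 2 * η) * y ≤ (1 + δ) * y := by gcongr
    linarith)
  have hlist' : ((q : ℝ) ^ 2 + q + 1) ≤ H.listEdgeChromaticNumber := by exact_mod_cast hlist
  -- The contradiction: `q ^ 2 + q + 1` colors are needed, but validity allows at most `c n = y ^ 2
  -- ≤ q ^ 2`.
  have hyq2 : y ^ 2 ≤ (q : ℝ) ^ 2 := by gcongr
  rw [← mul_div_assoc, hcn, ← hysq] at h
  linarith [(Nat.cast_nonneg q : (0 : ℝ) ≤ q)]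

theorem mainTheorem2 (i : ℕ) (hi : 3 ≤ i) (ε : ℝ) (hε : ε ∈ Set.Ioo (0 : ℝ) 1)
    (f : ℕ → ℝ → ℕ → ℝ) :
    (∀ δ : ℝ, 0 < δ →
      {n : ℕ | (1 + δ) * Real.sqrt ((1 + ε) * (n : ℝ) / ((i : ℝ) - 1)) < f i ε n}.Infinite →
      ¬ IsValidEdgeSizeBound i ε (fun n => f i ε n)) ∧
    (IsValidEdgeSizeBound i ε (fun n => f i ε n) →
      ∀ δ : ℝ, 0 < δ → ∀ᶠ n : ℕ in Filter.atTop,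
        f i ε n ≤ (1 + δ) * Real.sqrt ((1 + ε) / ((i : ℝ) - 1)) * Real.sqrt (n : ℝ)) := by
  refine ⟨fun δ hδ hinf => not_isValidEdgeSizeBound_of_infinite hi hε.1 hε.2 hδ hinf,
    fun hvalid δ hδ => ?_⟩
  by_contra hev
  rw [Filter.not_eventually, Nat.frequently_atTop_iff_infinite] at hev
  refine not_isValidEdgeSizeBound_of_infinite hi hε.1 hε.2 hδ (hev.mono fun n hn => ?_) hvalid
  have hi1 : (0 : ℝ) ≤ (i : ℝ) - 1 := by
    have : (3 : ℝ) ≤ i := by exact_mod_cast hi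
    linarith
  rw [Set.mem_ofPred_eq, not_le, mul_assoc,
    ← Real.sqrt_mul (div_nonneg (by linarith [hε.1]) hi1)] at hn
  rwa [Set.mem_ofPred_eq, mul_div_right_comm]
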